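/- All graphs are finite and simple. A tree $2$-spanner of a graph $G$ is a spanning tree $T$ of $G$ with $d_T(u,v)\le 2\,d_G(u,v)$ for all vertices $u,v$; $G$ is $2$-admissible if it has a tree $2$-spanner. $G$ is $P_4$-sparse if every set of five vertices contains at most one induced path $P_4$ on four vertices. $G$ is a thin spider if its vertex set can be partitioned into $S,K,R$ such that $K$ is a clique, $S$ is an independent set, $|S|=|K|\ge 2$, every vertex of $R$ is adjacent to all vertices of $K$ and to no vertex of $S$, and there is a bijection $f\colon S\to K$ with $N(x)=\{f(x)\}$ for all $x\in S$. **Theorem.** $2$-admissibility can be decided in $O(n)$ time for $P_4$-sparse graphs with $n$ vertices, using the degree sequence to check for a universal vertex or for the structure of a thin spider. Precisely: 1. A $P_4$-sparse graph $G$ is $2$-admissible if and only if $G$ has a universal vertex (one that is adjacent to all other vertices) or $G$ is a thin spider. 2. There is a program for a random access machine (unit cost per instruction; arithmetic only by $\pm1$, copying, comparison, indirect addressing) which, given a $P_4$-sparse graph $G$ on the vertices $0,\dots,n-1$ by adjacency lists stored with their lengths, so that $n$ and the degree of any vertex can each be read in one step, halts after $O(n)$ steps and accepts if and only if $G$ is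 $2$-admissible. The program reads nothing of $G$ but $n$ and the degrees of vertices. -/

import Mathlib

namespace Admissibility

/-! ### Graph notions -/

section Graphs

variable {V : Type*}

/-- `T` is a tree `t`-spanner of `G`: a spanning tree of `G` in which the distance between any two
vertices is at most `t` times their distance in `G`. -/
def IsTreeSpanner (G : SimpleGraph V) (t : ℕ) (T : SimpleGraph V) : Prop :=
  T ≤ G ∧ T.IsTree ∧ ∀ u v : V, T.dist u v ≤ t * G.dist u v

/-- `G` is `t`-admissible: it has a tree `t`-spanner. -/
def IsAdmissible (G : SimpleGraph V) (t : ℕ) : Prop :=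
  ∃ T : SimpleGraph V, IsTreeSpanner G t T

/-- The vertex set `s` induces a path on four vertices in `G`. -/
def InducesP4 (G : SimpleGraph V) (s : Finset V) : Prop :=
  Nonempty (G.induce (s : Set V) ≃g SimpleGraph.pathGraph 4)

/-- `G` is `P₄`-sparse: every set of five vertices contains at most one induced `P₄`. -/
def IsP4Sparse (G : SimpleGraph V) : Prop :=
  ∀ s : Finset V, s.card = 5 → {p : Finset V | p ⊆ s ∧ InducesP4 G p}.Subsingleton

/-- Some vertex of `G` is adjacent to all the other vertices. -/
def HasUniversalVertex (G : SimpleGraph V) : Prop :=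
  ∃ v : V, ∀ w : V, w ≠ v → G.Adj v w

/-- The part common to thin and thick spiders: `S`, `K`, `R` partition the vertex set, `K` is a
clique, `S` is an independent set, `|S| = |K| ≥ 2`, and every vertex of `R` is adjacent to all of
`K` and to nothing in `S`. -/
structure IsSpiderPartition (G : SimpleGraph V) (S K R : Finset V) : Prop where
  disjoint_S_K : Disjoint S K
  disjoint_S_R : Disjoint S R
  disjoint_K_R : Disjoint K R
  cover : ∀ v : V, v ∈ S ∨ v ∈ K ∨ v ∈ R
  clique : G.IsClique (K : Set V)
  indep : G.IsIndepSet (S : Set V)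
  card_eq : S.card = K.card
  two_le : 2 ≤ K.card
  adj_R_K : ∀ r ∈ R, ∀ k ∈ K, G.Adj r k
  not_adj_R_S : ∀ r ∈ R, ∀ s ∈ S, ¬ G.Adj r s

/-- `G` is a thin spider: it has a spider partition and a bijection `f : S → K` such that
`N(x) = {f x}` for all `x ∈ S`. -/
def IsThinSpider (G : SimpleGraph V) : Prop :=
  ∃ S K R : Finset V, IsSpiderPartition G S K R ∧
    ∃ f : {x // x ∈ S} ≃ {x // x ∈ K}, ∀ x, G.neighborSet x.1 = {(f x).1}

end Graphs

/-! ### The input of an algorithm -/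

/-- An adjacency list representation of a graph on the vertices `0, …, n - 1`: for each vertex, a
list of its neighbours, without repetition and in an arbitrary order. -/
structure AdjacencyLists {n : ℕ} (G : SimpleGraph (Fin n)) where
  nbrs : Fin n → List (Fin n)
  nodup : ∀ v, (nbrs v).Nodup
  mem_nbrs : ∀ v w, w ∈ nbrs v ↔ G.Adj v w

namespace AdjacencyLists

variable {n : ℕ} {G : SimpleGraph (Fin n)}

/-- The length of the list of vertex `v`, which is the degree of `v` (and `0` if there is no
vertex `v`). -/
def degreeAt (A : AdjacencyLists G) (v : ℕ) : ℕ :=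
  if h : v < n then (A.nbrs ⟨v, h⟩).length else 0

/-- Entry number `i` of the list of vertex `v` (and `0` if there is no such entry). -/
def neighborAt (A : AdjacencyLists G) (v i : ℕ) : ℕ :=
  if h : v < n then (((A.nbrs ⟨v, h⟩)[i]?).map Fin.val).getD 0 else 0

end AdjacencyLists

/-! ### Random access machines

The memory consists of the cells `X 0, X 1, X 2, …`, each holding a natural number. Every
instruction costs one step. The only arithmetic is adding and subtracting one, so all the numbers
that occur in the first `t` steps on an `n`-vertex graph are at most `n + t` plus a constant that
depends on the program only: for `t = O(n)` they fit into words of `O(log n)` bits. -/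

/-- The instructions. The graph is accessible through `order`, `degree` and `neighbor`. -/
inductive Instr where
  /-- `X d := k` -/
  | const (d k : ℕ)
  /-- `X d := X s` -/
  | copy (d s : ℕ)
  /-- `X d := X d + 1` -/
  | incr (d : ℕ)
  /-- `X d := X d - 1`, where `0 - 1 = 0` -/
  | decr (d : ℕ)
  /-- `X d := X (X s)` -/
  | load (d s : ℕ)
  /-- `X (X d) := X s` -/
  | store (d s : ℕ)
  /-- `X d :=` the number of vertices -/
  | order (d : ℕ)
  /-- `X d :=` the degree of vertex number `X v` -/
  | degree (d v : ℕ)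
  /-- `X d :=` entry number `X i` of the adjacency list of vertex number `X v` -/
  | neighbor (d v i : ℕ)
  /-- go to instruction `l` -/
  | jump (l : ℕ)
  /-- go to instruction `l` if `X a = X b` -/
  | jumpEq (a b l : ℕ)
  /-- go to instruction `l` if `X a < X b` -/
  | jumpLt (a b l : ℕ)
  /-- stop, and accept (`true`) or reject (`false`) -/
  | halt (accept : Bool)

/-- A program is a finite list of instructions, numbered from `0`. -/
abbrev Program := List Instr

/-- A configuration: the number of the next instruction, and the contents of the memory. -/
structure Config where
  pc : ℕ
  mem : ℕ → ℕ

/-- Write `x` to cell `d` and go on to the next instruction. -/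
def Config.write (c : Config) (d x : ℕ) : Config :=
  ⟨c.pc + 1, Function.update c.mem d x⟩

/-- The effect of one instruction. -/
def Instr.exec {n : ℕ} {G : SimpleGraph (Fin n)} (A : AdjacencyLists G) (c : Config) :
    Instr → Config
  | .const d k => c.write d k
  | .copy d s => c.write d (c.mem s)
  | .incr d => c.write d (c.mem d + 1)
  | .decr d => c.write d (c.mem d - 1)
  | .load d s => c.write d (c.mem (c.mem s))
  | .store d s => c.write (c.mem d) (c.mem s)
  | .order d => c.write d n
  | .degree d v => c.write d (A.degreeAt (c.mem v))
  | .neighbor d v i => c.write d (A.neighborAt (c.mem v) (c.mem i))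
  | .jump l => ⟨l, c.mem⟩
  | .jumpEq a b l => ⟨if c.mem a = c.mem b then l else c.pc + 1, c.mem⟩
  | .jumpLt a b l => ⟨if c.mem a < c.mem b then l else c.pc + 1, c.mem⟩
  | .halt _ => c

/-- The answer of the program when it is started in configuration `c`, or `none` if it does not
execute a `halt` instruction within `t` steps. -/
def Program.run (P : Program) {n : ℕ} {G : SimpleGraph (Fin n)} (A : AdjacencyLists G) :
    ℕ → Config → Option Bool
  | 0, _ => none
  | t + 1, c =>
    match P[c.pc]? with
    | none => none
    | some (.halt b) => some b
    | some I => P.run A t (I.exec A c)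

/-- The initial configuration: the first instruction is next, and all cells hold `0`. -/
def Config.init : Config := ⟨0, fun _ => 0⟩

/-- On input `A`, the program halts within `t` steps, and it accepts if and only if `p` holds. -/
def Program.DecidesWithin (P : Program) {n : ℕ} {G : SimpleGraph (Fin n)} (A : AdjacencyLists G)
    (t : ℕ) (p : Prop) : Prop :=
  ∃ b : Bool, P.run A t Config.init = some b ∧ (b = true ↔ p)

/-- The program never looks at an entry of an adjacency list: all that it can learn about the graph
is the number of vertices and the degree sequence. -/
def Program.UsesOnlyDegrees (P : Program) : Prop :=
  ∀ d v i : ℕ, Instr.neighbor d v i ∉ P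

end Admissibility

/-! Easy direction: if a vertex `r` is adjacent to everything except some pendant vertices, the star
at `r` with the pendants hung on their neighbours is a tree `2`-spanner. This covers universal
vertices and thin spiders.

Conversely, let `T` be a tree `2`-spanner. An induced four-cycle, or a triangle with an extra vertex
opposite each corner, must lie in a star of `T` whose centre is a further vertex, since otherwise a
nonbacktracking walk of `T` joins two adjacent vertices of `G` at distance at least three. Without a
universal vertex, a vertex `w` of maximum degree starts a path `w x y` with `w`, `y` not adjacent,
and maximality gives a neighbour `u` of `w` missing `x`. If `u` sees `y`, there is a four-cycle, and
its star leads either to a triangle in `T` or to two induced paths within five vertices. Otherwise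
`u w x y` is an induced path. A vertex adjacent to all of it would again force a triangle in `T`;
without such a vertex, sparseness and connectedness build a thin spider around the path
(`IsP4Sparse.isThinSpider`).

For the algorithm, a universal vertex has degree `n - 1`, and a graph is a thin spider exactly when
it has `k ≥ 2` leaves, `n - k ≠ 1`, and at least `k` vertices of degree `n - k`
(`isThinSpider_iff_degree`). Two passes over the degrees check this. -/

namespace Admissibility

/-! ### Local structure of tree `2`-spanners: distances in forests and stars. -/

section Trees

variable {V : Type*} {G T : SimpleGraph V}

/-- In an acyclic graph the length of a walk without backtracking is the distance of its ends. -/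
theorem length_eq_dist_of_isChain (hT : T.IsAcyclic) {u v : V} (p : T.Walk u v)
    (hp : List.IsChain (· ≠ ·) p.edges) : p.length = T.dist u v := by
  obtain ⟨q, hq, hl⟩ := p.reachable.exists_path_of_dist
  have h := (hT.subsingleton_path u v).elim ⟨p, (hT.isPath_iff_isChain p).2 hp⟩ ⟨q, hq⟩
  rw [← hl, congrArg (fun r : T.Path u v => r.1.length) h]

/-- A walk in a forest backtracks only if two vertices two steps apart on it coincide, so the
inequalities suffice. These exact distances serve to contradict the bound two for edges of `G`. -/
theorem dist_eq_three (hT : T.IsAcyclic) {a b c d : V} (hab : T.Adj a b) (hbc : T.Adj b c)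
    (hcd : T.Adj c d) (hac : a ≠ c) (hbd : b ≠ d) : T.dist a d = 3 := by
  have := length_eq_dist_of_isChain hT (.cons hab (.cons hbc (.cons hcd .nil)))
    (by simp [hac, hbd, hab.ne, hbc.ne])
  simpa using this.symm

theorem dist_eq_four (hT : T.IsAcyclic) {a b c d e : V} (hab : T.Adj a b) (hbc : T.Adj b c)
    (hcd : T.Adj c d) (hde : T.Adj d e) (hac : a ≠ c) (hbd : b ≠ d) (hce : c ≠ e) :
    T.dist a e = 4 := by
  have := length_eq_dist_of_isChain hT (.cons hab (.cons hbc (.cons hcd (.cons hde .nil))))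
    (by simp [hac, hbd, hce, hab.ne, hbc.ne, hcd.ne])
  simpa using this.symm

theorem dist_eq_five (hT : T.IsAcyclic) {a b c d e f : V} (hab : T.Adj a b) (hbc : T.Adj b c)
    (hcd : T.Adj c d) (hde : T.Adj d e) (hef : T.Adj e f) (hac : a ≠ c) (hbd : b ≠ d)
    (hce : c ≠ e) (hdf : d ≠ f) : T.dist a f = 5 := by
  have := length_eq_dist_of_isChain hT
    (.cons hab (.cons hbc (.cons hcd (.cons hde (.cons hef .nil)))))
    (by simp [hac, hbd, hce, hdf, hab.ne, hbc.ne, hcd.ne, hde.ne])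
  simpa using this.symm

theorem dist_eq_six (hT : T.IsAcyclic) {a b c d e f g : V} (hab : T.Adj a b) (hbc : T.Adj b c)
    (hcd : T.Adj c d) (hde : T.Adj d e) (hef : T.Adj e f) (hfg : T.Adj f g) (hac : a ≠ c)
    (hbd : b ≠ d) (hce : c ≠ e) (hdf : d ≠ f) (heg : e ≠ g) : T.dist a g = 6 := by
  have := length_eq_dist_of_isChain hT
    (.cons hab (.cons hbc (.cons hcd (.cons hde (.cons hef (.cons hfg .nil))))))
    (by simp [hac, hbd, hce, hdf, heg, hab.ne, hbc.ne, hcd.ne, hde.ne, hef.ne])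
  simpa using this.symm

theorem not_adj_of_adj_of_adj (hT : T.IsAcyclic) {a b c : V} (hab : T.Adj a b) (hbc : T.Adj b c) :
    ¬ T.Adj a c := by
  intro hac
  have h := dist_eq_three hT hab hbc hac.symm hac.ne hab.ne'
  simp at h

theorem IsTreeSpanner.isAcyclic {t : ℕ} (h : IsTreeSpanner G t T) : T.IsAcyclic := h.2.1.isAcyclic

theorem IsTreeSpanner.dist_le_two (h : IsTreeSpanner G 2 T) {u v : V} (huv : G.Adj u v) :
    T.dist u v ≤ 2 := by
  have := h.2.2 u v
  rwa [SimpleGraph.dist_eq_one_iff_adj.2 huv] at this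

theorem IsTreeSpanner.adj_or_exists (h : IsTreeSpanner G 2 T) {u v : V} (huv : G.Adj u v) :
    T.Adj u v ∨ ∃ m, T.Adj u m ∧ T.Adj m v := by
  have h2 := h.dist_le_two huv
  obtain ⟨p, hp⟩ := h.2.1.connected.exists_walk_length_eq_dist u v
  rw [← hp] at h2
  match p, h2 with
  | .nil, _ => exact absurd huv (G.irrefl)
  | .cons a .nil, _ => exact .inl a
  | .cons a (.cons b .nil), _ => exact .inr ⟨_, a, b⟩
  | .cons _ (.cons _ (.cons _ _)), h2 => simp at h2

/-- A common neighbour, in the graph, of two tree neighbours of `p` is `p` or a tree neighbour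
of `p`. -/
theorem IsTreeSpanner.eq_or_adj_center (h : IsTreeSpanner G 2 T) {p a b u : V} (ha : T.Adj p a)
    (hb : T.Adj p b) (hab : a ≠ b) (hua : G.Adj u a) (hub : G.Adj u b) : u = p ∨ T.Adj p u := by
  by_contra! hc
  have h2 := h.dist_le_two hub
  -- Unless the tree connection from `u` to `a` goes through `p`, prolonging it by `p` and `b` gives
  -- distance three or four between `u` and `b`.
  rcases h.adj_or_exists hua with h1 | ⟨m, hm, hm'⟩
  · have := dist_eq_three h.isAcyclic h1 ha.symm hb hc.1 hab
    omega
  · by_cases hmp : m = p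
    · subst hmp
      exact hc.2 hm.symm
    · have := dist_eq_four h.isAcyclic hm hm' ha.symm hb hua.ne hmp hab
      omega

/-- The edges `ab`, `bc`, `cd`, `da` form an induced cycle of length four. -/
structure IsInducedC4 (G : SimpleGraph V) (a b c d : V) : Prop where
  ab : G.Adj a b
  bc : G.Adj b c
  cd : G.Adj c d
  da : G.Adj d a
  ac : ¬ G.Adj a c
  bd : ¬ G.Adj b d
  ac_ne : a ≠ c
  bd_ne : b ≠ d

theorem IsInducedC4.rotate {a b c d : V} (h : IsInducedC4 G a b c d) : IsInducedC4 G b c d a :=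
  ⟨h.bc, h.cd, h.da, h.ab, h.bd, fun k => h.ac k.symm, h.bd_ne, h.ac_ne.symm⟩

/-- If `ab` and `bc` are both tree edges, `d` must be attached to their common end `b`, against the
missing chord. Otherwise `bc` is bridged by a midpoint, and the walk from `d` through `a` and `b` to
`c` has length four or five although `cd` is an edge of `G`. -/
theorem IsTreeSpanner.not_adj_of_isInducedC4 (h : IsTreeSpanner G 2 T) {a b c d : V}
    (hC : IsInducedC4 G a b c d) : ¬ T.Adj a b := by
  intro hab
  have hle := h.1
  have hcd := h.dist_le_two hC.cd
  rcases h.adj_or_exists hC.bc with hbc | ⟨m, hbm, hmc⟩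
  · rcases h.eq_or_adj_center hab.symm hbc hC.ac_ne hC.da hC.cd.symm with h1 | h1
    · exact hC.bd_ne h1.symm
    · exact hC.bd (hle h1)
  · have hma : a ≠ m := by
      rintro rfl
      exact hC.ac (hle hmc)
    rcases h.adj_or_exists hC.da with hda | ⟨k, hdk, hka⟩
    · have := dist_eq_four h.isAcyclic hda hab hbm hmc hC.bd_ne.symm hma hC.bc.ne
      rw [SimpleGraph.dist_comm] at this
      omega
    · have hkb : k ≠ b := by
        rintro rfl
        exact hC.bd (hle hdk.symm)
      have := dist_eq_five h.isAcyclic hdk hka hab hbm hmc hC.da.ne hkb hma hC.bc.ne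
      rw [SimpleGraph.dist_comm] at this
      omega

/-- An induced cycle of length four lies in a star of the tree. -/
theorem IsTreeSpanner.exists_center_of_isInducedC4 (h : IsTreeSpanner G 2 T) {a b c d : V}
    (hC : IsInducedC4 G a b c d) :
    ∃ p, T.Adj p a ∧ T.Adj p b ∧ T.Adj p c ∧ T.Adj p d := by
  have key : ∀ {a b c d p : V}, IsInducedC4 G a b c d → T.Adj p a → T.Adj p b → T.Adj p c →
      T.Adj p d := by
    intro a b c d p hC ha hb hc
    rcases h.eq_or_adj_center ha hc hC.ac_ne hC.da hC.cd.symm with h1 | h1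
    · subst h1
      exact absurd (h.1 hb.symm) hC.bd
    · exact h1
  obtain ⟨k, hak, hkb⟩ := (h.adj_or_exists hC.ab).resolve_left (h.not_adj_of_isInducedC4 hC)
  obtain ⟨l, hbl, hlc⟩ := (h.adj_or_exists hC.bc).resolve_left (h.not_adj_of_isInducedC4 hC.rotate)
  obtain ⟨m, hcm, hmd⟩ := (h.adj_or_exists hC.cd).resolve_left
    (h.not_adj_of_isInducedC4 hC.rotate.rotate)
  by_cases hkl : k = l
  · subst hkl
    exact ⟨k, hak.symm, hkb, hlc, key hC hak.symm hkb hlc⟩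
  by_cases hlm : l = m
  · subst hlm
    exact ⟨l, key hC.rotate hbl.symm hlc hmd, hbl.symm, hlc, hmd⟩
  -- If consecutive midpoints differ, the walk `a k b l c m d` does not backtrack, while `a` and `d`
  -- are adjacent in `G`.
  have := dist_eq_six h.isAcyclic hak hkb hbl hlc hcm hmd hC.ab.ne hkl hC.bc.ne hlm hC.cd.ne
  have h2 := h.dist_le_two hC.da
  rw [SimpleGraph.dist_comm] at h2
  omega

/-- A triangle lies in a star of the tree. -/
theorem IsTreeSpanner.exists_center_of_triangle (h : IsTreeSpanner G 2 T) {x y z : V}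
    (hxy : G.Adj x y) (hyz : G.Adj y z) (hxz : G.Adj x z) :
    (T.Adj x y ∧ T.Adj x z) ∨ (T.Adj y x ∧ T.Adj y z) ∨ (T.Adj z x ∧ T.Adj z y) ∨
      ∃ p, T.Adj p x ∧ T.Adj p y ∧ T.Adj p z := by
  have key : ∀ {x y z : V}, G.Adj x y → G.Adj y z → G.Adj x z → T.Adj x y →
      (T.Adj x y ∧ T.Adj x z) ∨ (T.Adj y x ∧ T.Adj y z) := by
    intro x y z hxy hyz hxz hT
    rcases h.adj_or_exists hxz with h1 | ⟨m, h1, h2⟩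
    · exact .inl ⟨hT, h1⟩
    · by_cases hm : m = y
      · subst hm
        exact .inr ⟨hT.symm, h2⟩
      · have h3 := dist_eq_three h.isAcyclic hT.symm h1 h2 (Ne.symm hm) hxz.ne
        have h4 := h.dist_le_two hyz
        omega
  rcases h.adj_or_exists hxy with h1 | ⟨m, hm, hm'⟩
  · rcases key hxy hyz hxz h1 with h | h <;> simp [h]
  rcases h.adj_or_exists hyz with h1 | ⟨k, hk, hk'⟩
  · rcases key hyz hxz.symm hxy.symm h1 with h | h <;> simp [h]
  by_cases hmk : m = k
  · subst hmk
    exact .inr (.inr (.inr ⟨m, hm.symm, hm', hk'⟩))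
  · have h3 := dist_eq_four h.isAcyclic hm hm' hk hk' hxy.ne hmk hyz.ne
    have h4 := h.dist_le_two hxz
    omega

/-- A triangle `x`, `y`, `z` with a private common neighbour `x'`, `y'`, `z'` opposite to each
corner lies in a star of the tree, together with these neighbours. -/
theorem IsTreeSpanner.exists_center_of_sun (h : IsTreeSpanner G 2 T) {x y z x' y' z' : V}
    (hxy : G.Adj x y) (hyz : G.Adj y z) (hxz : G.Adj x z)
    (hx : ¬ G.Adj x x') (hxy' : G.Adj x y') (hxz' : G.Adj x z')
    (hyx' : G.Adj y x') (hy : ¬ G.Adj y y') (hyz' : G.Adj y z')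
    (hzx' : G.Adj z x') (hzy' : G.Adj z y') (hz : ¬ G.Adj z z')
    (hx_ne : x ≠ x') (hy_ne : y ≠ y') (hz_ne : z ≠ z') :
    ∃ p, T.Adj p x ∧ T.Adj p y ∧ T.Adj p z ∧ T.Adj p x' ∧ T.Adj p y' ∧ T.Adj p z' := by
  have hle := h.1
  -- The centre cannot be a corner: the extra vertex opposite that corner sees the two others, so it
  -- would be attached to the corner, which it misses.
  rcases h.exists_center_of_triangle hxy hyz hxz with h1 | h1 | h1 | ⟨p, hpx, hpy, hpz⟩
  · rcases h.eq_or_adj_center h1.1 h1.2 hyz.ne hyx'.symm hzx'.symm with e | e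
    · exact absurd e.symm hx_ne
    · exact absurd (hle e) hx
  · rcases h.eq_or_adj_center h1.1 h1.2 hxz.ne hxy'.symm hzy'.symm with e | e
    · exact absurd e.symm hy_ne
    · exact absurd (hle e) hy
  · rcases h.eq_or_adj_center h1.1 h1.2 hxy.ne hxz'.symm hyz'.symm with e | e
    · exact absurd e.symm hz_ne
    · exact absurd (hle e) hz
  · refine ⟨p, hpx, hpy, hpz, ?_, ?_, ?_⟩
    · refine (h.eq_or_adj_center hpy hpz hyz.ne hyx'.symm hzx'.symm).resolve_left ?_
      rintro rfl
      exact hx (hle hpx.symm)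
    · refine (h.eq_or_adj_center hpx hpz hxz.ne hxy'.symm hzy'.symm).resolve_left ?_
      rintro rfl
      exact hy (hle hpy.symm)
    · refine (h.eq_or_adj_center hpx hpy hxy.ne hxz'.symm hyz'.symm).resolve_left ?_
      rintro rfl
      exact hz (hle hpz.symm)

end Trees

/-! ### Induced paths in `P₄`-sparse graphs. -/

section Sparse

variable {V : Type*} {G : SimpleGraph V}

/-- The vertices `a`, `b`, `c`, `d` form, in this order, an induced path. -/
structure IsInducedP4 (G : SimpleGraph V) (a b c d : V) : Prop where
  ab : G.Adj a b
  bc : G.Adj b c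
  cd : G.Adj c d
  ac : ¬ G.Adj a c
  bd : ¬ G.Adj b d
  ad : ¬ G.Adj a d

theorem isInducedP4_iff {a b c d : V} : IsInducedP4 G a b c d ↔
    G.Adj a b ∧ G.Adj b c ∧ G.Adj c d ∧ ¬ G.Adj a c ∧ ¬ G.Adj b d ∧ ¬ G.Adj a d :=
  ⟨fun h => ⟨h.ab, h.bc, h.cd, h.ac, h.bd, h.ad⟩,
    fun ⟨h1, h2, h3, h4, h5, h6⟩ => ⟨h1, h2, h3, h4, h5, h6⟩⟩

namespace IsInducedP4

variable {a b c d : V}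

theorem reverse (h : IsInducedP4 G a b c d) : IsInducedP4 G d c b a :=
  ⟨h.cd.symm, h.bc.symm, h.ab.symm, fun k => h.bd k.symm, fun k => h.ac k.symm,
    fun k => h.ad k.symm⟩

/-- Distinctness need not be a field of `IsInducedP4`: identifying two vertices would turn one of
the edges into one of the non-edges. -/
theorem ac_ne (h : IsInducedP4 G a b c d) : a ≠ c := by
  rintro rfl
  exact h.ad h.cd

theorem bd_ne (h : IsInducedP4 G a b c d) : b ≠ d := by
  rintro rfl
  exact h.ad h.ab

theorem ad_ne (h : IsInducedP4 G a b c d) : a ≠ d := by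
  rintro rfl
  exact h.ac h.cd.symm

theorem card_eq [DecidableEq V] (h : IsInducedP4 G a b c d) :
    ({a, b, c, d} : Finset V).card = 4 := by
  simp [Finset.card_insert_of_notMem, h.ab.ne, h.bc.ne, h.cd.ne, h.ac_ne, h.bd_ne, h.ad_ne]

theorem inducesP4 [DecidableEq V] (h : IsInducedP4 G a b c d) : InducesP4 G {a, b, c, d} := by
  let f : Fin 4 → {x // x ∈ (({a, b, c, d} : Finset V) : Set V)} :=
    ![⟨a, by simp⟩, ⟨b, by simp⟩, ⟨c, by simp⟩, ⟨d, by simp⟩]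
  have hf : Function.Bijective f := by
    constructor
    · rw [← List.nodup_ofFn]
      simp [f, List.ofFn_succ, h.ab.ne, h.bc.ne, h.cd.ne, h.ac_ne, h.bd_ne, h.ad_ne]
    · rintro ⟨x, hx⟩
      simp only [Finset.coe_insert, Finset.coe_singleton, Set.mem_insert_iff,
        Set.mem_singleton_iff] at hx
      rcases hx with rfl | rfl | rfl | rfl
      exacts [⟨0, rfl⟩, ⟨1, rfl⟩, ⟨2, rfl⟩, ⟨3, rfl⟩]
  refine ⟨(RelIso.mk (Equiv.ofBijective f hf) ?_ :
    SimpleGraph.pathGraph 4 ≃g G.induce (({a, b, c, d} : Finset V) : Set V)).symm⟩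
  have key : ∀ i j, G.Adj (![a, b, c, d] i) (![a, b, c, d] j) ↔
      (SimpleGraph.pathGraph 4).Adj i j := by
    simp [Fin.forall_fin_succ, SimpleGraph.pathGraph_adj, h.ab, h.bc, h.cd, h.ac, h.bd, h.ad,
      h.ab.symm, h.bc.symm, h.cd.symm, h.reverse.ac, h.reverse.bd, h.reverse.ad]
  intro i j
  rw [← key]
  fin_cases i <;> fin_cases j <;> rfl

end IsInducedP4

/-- Two induced paths on four vertices within five vertices have the same vertices. -/
theorem IsP4Sparse.not_isInducedP4 (hG : IsP4Sparse G) {a b c d x p q r s : V}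
    (h : IsInducedP4 G a b c d) (h' : IsInducedP4 G p q r s)
    (hx : x ∉ [a, b, c, d]) (hx' : x ∈ [p, q, r, s])
    (hsub : [p, q, r, s] ⊆ [x, a, b, c, d]) : False := by
  classical
  have hcard : ({x, a, b, c, d} : Finset V).card = 5 := by
    rw [Finset.card_insert_of_notMem (by simpa using hx), h.card_eq]
  have h1 : ({a, b, c, d} : Finset V) ∈ {p : Finset V | p ⊆ {x, a, b, c, d} ∧ InducesP4 G p} :=
    ⟨Finset.subset_insert _ _, h.inducesP4⟩
  have h2 : ({p, q, r, s} : Finset V) ∈ {p : Finset V | p ⊆ {x, a, b, c, d} ∧ InducesP4 G p} := by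
    refine ⟨fun y hy => ?_, h'.inducesP4⟩
    simpa using hsub (by simpa using hy : y ∈ [p, q, r, s])
  have h3 : x ∈ ({p, q, r, s} : Finset V) := by simpa using hx'
  rw [hG _ hcard h2 h1] at h3
  exact hx (by simpa using h3)

/-- A vertex outside an induced path `abcd` is adjacent to none of its vertices, to its two midpoints
only, or to all of its vertices. -/
theorem IsP4Sparse.adj_cases (hG : IsP4Sparse G) {a b c d x : V} (h : IsInducedP4 G a b c d)
    (hx : x ∉ [a, b, c, d]) :
    (¬ G.Adj x a ∧ ¬ G.Adj x b ∧ ¬ G.Adj x c ∧ ¬ G.Adj x d) ∨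
      (¬ G.Adj x a ∧ G.Adj x b ∧ G.Adj x c ∧ ¬ G.Adj x d) ∨
      (G.Adj x a ∧ G.Adj x b ∧ G.Adj x c ∧ G.Adj x d) := by
  have key : ∀ {p q r s : V}, x ∈ [p, q, r, s] → [p, q, r, s] ⊆ [x, a, b, c, d] →
    ¬ IsInducedP4 G p q r s := fun h1 h2 h' => hG.not_isInducedP4 h h' hx h1 h2
  -- These eight paths through `x` exclude thirteen of the sixteen possible adjacency patterns.
  have h1 : ¬ IsInducedP4 G x a b c := key (by simp) (by simp)
  have h2 : ¬ IsInducedP4 G x b c d := key (by simp) (by simp)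
  have h3 : ¬ IsInducedP4 G a b c x := key (by simp) (by simp)
  have h4 : ¬ IsInducedP4 G b c d x := key (by simp) (by simp)
  have h5 : ¬ IsInducedP4 G a x c d := key (by simp) (by simp)
  have h6 : ¬ IsInducedP4 G a b x d := key (by simp) (by simp)
  have h7 : ¬ IsInducedP4 G c d x a := key (by simp) (by simp)
  have h8 : ¬ IsInducedP4 G b a x d := key (by simp) (by simp)
  have hs := G.adj_comm
  obtain ⟨ab, bc, cd, ac, bd, ad⟩ := h
  simp only [isInducedP4_iff] at h1 h2 h3 h4 h5 h6 h7 h8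
  rw [hs a x, hs b x, hs c x, hs d x] at *
  rw [hs d a, hs c a] at h7
  rw [hs b a] at h8
  simp only [ab, bc, cd, ac, bd, ad, not_false_eq_true, true_and, and_true]
    at h1 h2 h3 h4 h5 h6 h7 h8
  clear hs key hx hG
  by_cases ha : G.Adj x a <;> by_cases hb : G.Adj x b <;> by_cases hc : G.Adj x c <;>
    by_cases hd : G.Adj x d <;> simp_all

end Sparse

/-! ### From a tree `2`-spanner to a universal vertex or a thin spider. -/

section Forward

variable {V : Type*} {G T : SimpleGraph V}

/-- A criterion for thin spiders in terms of the legs `S` and the body `K` only. -/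
theorem isThinSpider_of_forall [Fintype V] [DecidableEq V] {S K : Finset V} (hSK : Disjoint S K)
    (hK : G.IsClique (K : Set V)) (h2 : 2 ≤ K.card)
    (hS : ∀ s ∈ S, ∃ k ∈ K, G.neighborSet s = {k}) (hKS : ∀ k ∈ K, ∃! s, s ∈ S ∧ G.Adj s k)
    (hR : ∀ r, r ∉ S → r ∉ K → ∀ k ∈ K, G.Adj r k) : IsThinSpider G := by
  choose! f hfK hf using hS
  have hadj : ∀ s ∈ S, ∀ v, G.Adj s v ↔ v = f s := fun s hs v => by
    rw [← SimpleGraph.mem_neighborSet, hf s hs, Set.mem_singleton_iff]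
  have hbij : Function.Bijective (fun s : {x // x ∈ S} => (⟨f s.1, hfK s.1 s.2⟩ : {x // x ∈ K})) := by
    constructor
    · rintro ⟨s, hs⟩ ⟨t, ht⟩ hst
      have hst : f s = f t := congrArg Subtype.val hst
      refine Subtype.ext ((hKS (f s) (hfK s hs)).unique ⟨hs, ?_⟩ ⟨ht, ?_⟩)
      · rw [hadj s hs]
      · rw [hadj t ht, hst]
    · rintro ⟨k, hk⟩
      obtain ⟨s, ⟨hs, hsk⟩, -⟩ := hKS k hk
      exact ⟨⟨s, hs⟩, Subtype.ext ((hadj s hs k).1 hsk).symm⟩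
  let e := Equiv.ofBijective _ hbij
  refine ⟨S, K, (S ∪ K)ᶜ, ?_, e, fun x => hf x.1 x.2⟩
  have hnot : ∀ s ∈ S, ∀ v, v ∉ K → ¬ G.Adj s v := fun s hs v hv h =>
    hv ((hadj s hs v).1 h ▸ hfK s hs)
  constructor
  · exact hSK
  · exact (disjoint_compl_right (a := S ∪ K)).mono_left Finset.subset_union_left
  · exact (disjoint_compl_right (a := S ∪ K)).mono_left Finset.subset_union_right
  · intro v
    simp only [Finset.mem_compl, Finset.mem_union]
    tauto
  · exact hK
  · intro s hs t ht _
    exact hnot s hs t (Finset.disjoint_left.1 hSK ht)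
  · simpa using Fintype.card_congr e
  · exact h2
  · intro r hr
    simp only [Finset.mem_compl, Finset.mem_union, not_or] at hr
    exact hR r hr.1 hr.2
  · intro r hr s hs h
    simp only [Finset.mem_compl, Finset.mem_union, not_or] at hr
    exact hnot s hs r hr.2 h.symm

/-- In a connected `P₄`-sparse graph, an induced path on four vertices without a common neighbour
makes the graph a thin spider. -/
theorem IsP4Sparse.isThinSpider [Fintype V] (hG : IsP4Sparse G) (hconn : G.Connected)
    {a b c d : V} (h : IsInducedP4 G a b c d)
    (hfull : ∀ x, ¬ (G.Adj x a ∧ G.Adj x b ∧ G.Adj x c ∧ G.Adj x d)) : IsThinSpider G := by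
  classical
  -- Outside the path every vertex is `Null` or `Mid`. The `Null` vertices become legs; a `Mid`
  -- vertex belongs to the body if it has a `Null` neighbour and to the head otherwise.
  let Null : V → Prop := fun x =>
    x ∉ [a, b, c, d] ∧ ¬ G.Adj x a ∧ ¬ G.Adj x b ∧ ¬ G.Adj x c ∧ ¬ G.Adj x d
  let Mid : V → Prop := fun x =>
    x ∉ [a, b, c, d] ∧ ¬ G.Adj x a ∧ G.Adj x b ∧ G.Adj x c ∧ ¬ G.Adj x d
  have hcases : ∀ x, x ∉ [a, b, c, d] → Null x ∨ Mid x := fun x hx => by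
    rcases hG.adj_cases h hx with h1 | h1 | h1
    · exact .inl ⟨hx, h1⟩
    · exact .inr ⟨hx, h1⟩
    · exact absurd h1 (hfull x)
  have hP4 : ∀ {x y}, Mid x → Null y → G.Adj x y → IsInducedP4 G a b x y := fun hx hy hxy =>
    ⟨h.ab, hx.2.2.1.symm, hxy, fun k => hx.2.1 k.symm, fun k => hy.2.2.1 k.symm,
      fun k => hy.2.1 k.symm⟩
  -- `a b x y` is again an induced path. A further neighbour `z` of its end `y` would see the whole
  -- path, hence `a`, which neither `Null` nor `Mid` vertices do.
  have honly : ∀ {x y z}, Mid x → Null y → G.Adj x y → G.Adj z y → z = x := by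
    intro x y z hx hy hxy hzy
    by_contra hzx
    have hza : z ≠ a := fun e => hy.2.1 (e ▸ hzy.symm)
    have hzb : z ≠ b := fun e => hy.2.2.1 (e ▸ hzy.symm)
    have hzc : z ≠ c := fun e => hy.2.2.2.1 (e ▸ hzy.symm)
    have hzd : z ≠ d := fun e => hy.2.2.2.2 (e ▸ hzy.symm)
    have h1 := hG.adj_cases (hP4 hx hy hxy) (x := z) (by simp [hza, hzb, hzx, hzy.ne])
    have h2 := hcases z (by simp [hza, hzb, hzc, hzd])
    have : G.Adj z a := by tauto
    rcases h2 with h2 | h2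
    exacts [h2.2.1 this, h2.2.1 this]
  -- Relative to the path `a b x y`, the vertex `z` sees `b` but not `y`, so it sees exactly the
  -- midpoints `b` and `x`.
  have hmid : ∀ {x y z}, Mid x → Null y → G.Adj x y → G.Adj z b → z ≠ a → z ≠ x → G.Adj z x := by
    intro x y z hx hy hxy hzb hza hzx
    by_cases hzy : G.Adj z y
    · exact absurd (honly hx hy hxy hzy) hzx
    have hzy' : z ≠ y := fun e => hy.2.2.1 (e ▸ hzb)
    have h1 := hG.adj_cases (hP4 hx hy hxy) (x := z) (by simp [hza, hzb.ne, hzx, hzy'])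
    tauto
  have huniq : ∀ {x y z}, Mid x → Null y → Null z → G.Adj x y → G.Adj x z → z = y := by
    intro x y z hx hy hz hxy hxz
    by_contra hzy
    have hz1 := hz.1
    simp only [List.mem_cons, List.not_mem_nil, or_false, not_or] at hz1
    have h1 := hG.adj_cases (hP4 hx hy hxy) (x := z) (by simp [hz1, hxz.ne', hzy])
    have h2 := hz.2
    have h3 := hxz.symm
    tauto
  -- This is where connectedness enters, along a walk to `b`. A `Null` successor of `y` would by
  -- induction have a `Mid` neighbour as its only neighbour, so `y` would be `Mid`.
  have hnull : ∀ y, Null y → ∃ x, Mid x ∧ G.Adj x y := by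
    have key : ∀ {y w} (_ : G.Walk y w), ¬ Null w → Null y → ∃ x, Mid x ∧ G.Adj x y := by
      intro y w p hw
      induction p with
      | nil => exact fun hy => absurd hy hw
      | @cons y z w hyz p ih =>
        intro hy
        have hz : z ∉ [a, b, c, d] := by
          have := hy.2
          simp only [List.mem_cons, List.not_mem_nil, or_false, not_or]
          refine ⟨?_, ?_, ?_, ?_⟩ <;> rintro rfl <;> tauto
        rcases hcases z hz with hz | hz
        · obtain ⟨x, hx, hxz⟩ := ih hw hz
          exact absurd ((honly hx hz hxz hyz).symm ▸ hx.2.2.1) hy.2.2.1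
        · exact ⟨z, hz, hyz.symm⟩
    intro y
    obtain ⟨p⟩ := hconn.preconnected y b
    exact key p fun k => k.1 (by simp)
  have hna : ∀ z, G.Adj a z ↔ z = b := by
    intro z
    refine ⟨fun hz => ?_, fun e => e ▸ h.ab⟩
    by_contra hzb
    rcases hcases z (by
      have := h.ac; have := h.ad
      simp only [List.mem_cons, List.not_mem_nil, or_false, not_or]
      refine ⟨hz.ne', hzb, ?_, ?_⟩ <;> rintro rfl <;> contradiction) with h1 | h1
    exacts [h1.2.1 hz.symm, h1.2.1 hz.symm]
  have hnd : ∀ z, G.Adj d z ↔ z = c := by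
    intro z
    refine ⟨fun hz => ?_, fun e => e ▸ h.cd.symm⟩
    by_contra hzc
    rcases hcases z (by
      have := h.bd; have := h.ad
      simp only [List.mem_cons, List.not_mem_nil, or_false, not_or]
      refine ⟨?_, ?_, hzc, hz.ne'⟩ <;> rintro rfl <;> simp_all [G.adj_comm]) with h1 | h1
    exacts [h1.2.2.2.2 hz.symm, h1.2.2.2.2 hz.symm]
  let S : Finset V := Finset.univ.filter fun x => x = a ∨ x = d ∨ Null x
  let K : Finset V := Finset.univ.filter fun x => x = b ∨ x = c ∨ (Mid x ∧ ∃ y, Null y ∧ G.Adj x y)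
  have hmS : ∀ {x}, x ∈ S ↔ x = a ∨ x = d ∨ Null x := by simp [S]
  have hmK : ∀ {x}, x ∈ K ↔ x = b ∨ x = c ∨ (Mid x ∧ ∃ y, Null y ∧ G.Adj x y) := by simp [K]
  have hNb : ¬ Null b := fun k => k.1 (by simp)
  have hNc : ¬ Null c := fun k => k.1 (by simp)
  have hMa : ¬ Mid a := fun k => k.1 (by simp)
  have hMd : ¬ Mid d := fun k => k.1 (by simp)
  have hNM : ∀ {x}, Null x → ¬ Mid x := fun k k' => k.2.2.1 k'.2.2.1
  refine isThinSpider_of_forall (S := S) (K := K) ?_ ?_ ?_ ?_ ?_ ?_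
  · rw [Finset.disjoint_left]
    intro x hx hx'
    rw [hmS] at hx
    rw [hmK] at hx'
    rcases hx with rfl | rfl | hx
    · rcases hx' with e | e | e
      exacts [h.ab.ne e, h.ac_ne e, hMa e.1]
    · rcases hx' with e | e | e
      exacts [h.bd_ne e.symm, h.cd.ne e.symm, hMd e.1]
    · rcases hx' with rfl | rfl | hx'
      exacts [hNb hx, hNc hx, hNM hx hx'.1]
  · intro x hx y hy hxy
    rw [Finset.mem_coe, hmK] at hx hy
    have hm : ∀ {z}, z = b ∨ z = c ∨ (Mid z ∧ ∃ y, Null y ∧ G.Adj z y) → z ≠ b → G.Adj z b := by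
      rintro z (rfl | rfl | hz) hzb
      · exact absurd rfl hzb
      · exact h.bc.symm
      · exact hz.1.2.2.1
    by_cases hxb : x = b
    · subst hxb
      exact (hm hy hxy.symm).symm
    by_cases hyb : y = b
    · subst hyb
      exact hm hx hxb
    rcases hx with rfl | rfl | ⟨hx, u, hu, hxu⟩
    · exact absurd rfl hxb
    · rcases hy with rfl | rfl | ⟨hy, v, hv, hyv⟩
      · exact absurd rfl hyb
      · exact absurd rfl hxy
      · exact hy.2.2.2.1.symm
    · refine (hmid hx hu hxu (hm hy hyb) ?_ hxy.symm).symm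
      rintro rfl
      rcases hy with e | e | e
      exacts [h.ab.ne e, h.ac_ne e, hMa e.1]
  · refine le_trans (Finset.card_pair h.bc.ne).ge (Finset.card_le_card ?_)
    intro x hx
    rw [Finset.mem_insert, Finset.mem_singleton] at hx
    exact hmK.2 (hx.imp_right .inl)
  · intro s hs
    rcases hmS.1 hs with rfl | rfl | hs
    · exact ⟨b, hmK.2 (.inl rfl), Set.ext fun z => by simp [hna]⟩
    · exact ⟨c, hmK.2 (.inr (.inl rfl)), Set.ext fun z => by simp [hnd]⟩
    · obtain ⟨x, hx, hxs⟩ := hnull s hs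
      refine ⟨x, hmK.2 (.inr (.inr ⟨hx, s, hs, hxs⟩)), Set.ext fun z => ⟨fun hz => ?_, ?_⟩⟩
      · exact honly hx hs hxs (SimpleGraph.Adj.symm hz)
      · rintro rfl
        exact hxs.symm
  · intro k hk
    rcases hmK.1 hk with rfl | rfl | ⟨hx, y, hy, hxy⟩
    · refine ⟨a, ⟨hmS.2 (.inl rfl), h.ab⟩, ?_⟩
      rintro s ⟨hs, hsk⟩
      rcases hmS.1 hs with rfl | rfl | hs
      exacts [rfl, absurd hsk.symm h.bd, absurd hsk hs.2.2.1]
    · refine ⟨d, ⟨hmS.2 (.inr (.inl rfl)), h.cd.symm⟩, ?_⟩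
      rintro s ⟨hs, hsk⟩
      rcases hmS.1 hs with rfl | rfl | hs
      exacts [absurd hsk h.ac, rfl, absurd hsk hs.2.2.2.1]
    · refine ⟨y, ⟨hmS.2 (.inr (.inr hy)), hxy.symm⟩, ?_⟩
      rintro s ⟨hs, hsk⟩
      rcases hmS.1 hs with rfl | rfl | hs
      exacts [absurd hsk.symm hx.2.1, absurd hsk.symm hx.2.2.2.2, huniq hx hy hs hxy hsk.symm]
  · intro r hrS hrK k hk
    rw [hmS] at hrS
    rw [hmK] at hrK
    push Not at hrS hrK
    have hr : Mid r := (hcases r (by simp [hrS.1, hrS.2.1, hrK.1, hrK.2.1])).resolve_left hrS.2.2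
    rcases hmK.1 hk with rfl | rfl | ⟨hx, y, hy, hxy⟩
    · exact hr.2.2.1
    · exact hr.2.2.2.1
    · refine hmid hx hy hxy hr.2.2.1 hrS.1 ?_
      rintro rfl
      exact hrK.2.2 hr y hy hxy

/-- A vertex of maximum degree has, for each of its neighbours `z` with a neighbour that it misses
itself, a neighbour that `z` misses. -/
theorem exists_adj_not_adj_of_degree_le [Fintype V] [DecidableRel G.Adj] {w z y : V}
    (hw : G.degree z ≤ G.degree w) (hwz : G.Adj w z) (hzy : G.Adj z y) (hwy : ¬ G.Adj w y)
    (hne : y ≠ w) : ∃ v, G.Adj w v ∧ v ≠ z ∧ ¬ G.Adj z v := by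
  classical
  by_contra! hc
  -- If `z` saw all other neighbours of `w`, then the extra neighbour `y` would make its degree
  -- larger than that of `w`.
  have hsub : insert y ((G.neighborFinset w).erase z) ⊆ (G.neighborFinset z).erase w := by
    intro v hv
    simp only [Finset.mem_insert, Finset.mem_erase, SimpleGraph.mem_neighborFinset] at hv ⊢
    rcases hv with rfl | ⟨hvz, hwv⟩
    · exact ⟨hne, hzy⟩
    · exact ⟨hwv.ne', hc v hwv hvz⟩
  have h1 := Finset.card_le_card hsub
  rw [Finset.card_insert_of_notMem (by simp [hwy]), Finset.card_erase_of_mem (by simpa),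
    Finset.card_erase_of_mem (by simpa using hwz.symm), SimpleGraph.card_neighborFinset_eq_degree,
    SimpleGraph.card_neighborFinset_eq_degree] at h1
  have h2 : 0 < G.degree z := (G.degree_pos_iff_exists_adj z).2 ⟨y, hzy⟩
  omega

/-- A connected graph without a universal vertex has a vertex at distance two from any vertex. -/
theorem exists_adj_adj_not_adj (hconn : G.Connected) (hu : ¬ HasUniversalVertex G) (w : V) :
    ∃ x y, G.Adj w x ∧ G.Adj x y ∧ ¬ G.Adj w y ∧ y ≠ w := by
  by_contra! hc
  have key : ∀ {u v} (_ : G.Walk u v), u = w ∨ G.Adj w u → v = w ∨ G.Adj w v := by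
    intro u v p
    induction p with
    | nil => exact id
    | @cons a b c hab p ih =>
      rintro (rfl | ha)
      · exact ih (.inr hab)
      · refine ih ?_
        by_contra! hb
        exact hb.1 (hc a b ha hab hb.2)
  refine hu ⟨w, fun v hv => ?_⟩
  obtain ⟨p⟩ := hconn.preconnected w v
  exact (key p (.inl rfl)).resolve_left hv

/-- A `2`-admissible `P₄`-sparse graph has a universal vertex or is a thin spider. -/
theorem IsP4Sparse.hasUniversalVertex_or_isThinSpider [Fintype V] (hG : IsP4Sparse G)
    (hT : IsTreeSpanner G 2 T) : HasUniversalVertex G ∨ IsThinSpider G := by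
  classical
  refine or_iff_not_imp_left.2 fun hu => ?_
  have hconn : G.Connected := hT.2.1.connected.mono hT.1
  have := hconn.nonempty
  obtain ⟨w, -, hw⟩ := Finset.exists_max_image Finset.univ (fun v => G.degree v)
    Finset.univ_nonempty
  replace hw := fun z => hw z (Finset.mem_univ z)
  have hmax : ∀ {z y}, G.Adj w z → G.Adj z y → ¬ G.Adj w y → y ≠ w →
      ∃ v, G.Adj w v ∧ v ≠ z ∧ ¬ G.Adj z v := fun h1 h2 h3 h4 =>
    exists_adj_not_adj_of_degree_le (hw _) h1 h2 h3 h4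
  obtain ⟨x, y, hwx, hxy, hwy, hyw⟩ := exists_adj_adj_not_adj hconn hu w
  obtain ⟨u, hwu, hux, hxu⟩ := hmax hwx hxy hwy hyw
  have huy : u ≠ y := by
    rintro rfl
    exact hwy hwu
  have htri : ∀ {p q r}, T.Adj p q → T.Adj q r → ¬ T.Adj p r := fun h1 h2 =>
    not_adj_of_adj_of_adj hT.isAcyclic h1 h2
  have hle := hT.1
  by_cases hadj : G.Adj u y
  · exfalso
    have hC : IsInducedC4 G u w x y :=
      ⟨hwu.symm, hwx, hxy, hadj.symm, fun h => hxu h.symm, hwy, hux, hyw.symm⟩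
    obtain ⟨p, hpu, hpw, hpx, hpy⟩ := hT.exists_center_of_isInducedC4 hC
    -- The centre `p` sees `w` and also `y`, which `w` misses, so maximality applies to `p` itself.
    obtain ⟨v, hwv, hvp, hpv⟩ := hmax (hle hpw).symm (hle hpy) hwy hyw
    by_cases hvy : G.Adj v y
    -- A four-cycle through the tree edge `pw` would have its own centre `q`, closing a triangle in
    -- the tree.
    · obtain ⟨q, hq1, -, -, hq2⟩ := hT.exists_center_of_isInducedC4
        (⟨hwv, hvy, (hle hpy).symm, hle hpw, hwy, fun h => hpv h.symm, hyw.symm, hvp⟩ :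
          IsInducedC4 G w v y p)
      exact htri hq2 hpw hq1
    by_cases hvux : G.Adj v u ∧ G.Adj v x
    · obtain ⟨q, hq1, -, -, hq2⟩ := hT.exists_center_of_isInducedC4
        (⟨hvux.1.symm, hvux.2, (hle hpx).symm, hle hpu, fun h => hxu h.symm, fun h => hpv h.symm,
          hux, hvp⟩ : IsInducedC4 G u v x p)
      exact htri hq2 hpu hq1
    -- Now `v` sees `w` but not `y`, and at most one of `u`, `x`. In each case the five vertices of
    -- the four-cycle and `v` contain two induced paths.
    have hvu' : v ≠ u := fun e => hpv (e ▸ hle hpu)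
    have hvw' : v ≠ w := hwv.ne'
    have hvx' : v ≠ x := fun e => hpv (e ▸ hle hpx)
    have hvy' : v ≠ y := fun e => hpv (e ▸ hle hpy)
    have huy' := hadj.ne
    by_cases hvu : G.Adj v u
    · have hvx : ¬ G.Adj v x := fun h => hvux ⟨hvu, h⟩
      have h1 : IsInducedP4 G v w x y := ⟨hwv.symm, hwx, hxy, hvx, hwy, hvy⟩
      have h2 : IsInducedP4 G v u y x := ⟨hvu, hadj, hxy.symm, hvy, fun h => hxu h.symm, hvx⟩
      exact hG.not_isInducedP4 (x := u) h1 h2 (by simp [hvu'.symm, hwu.ne', hux, huy'])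
        (by simp) (by simp)
    · have h2 : IsInducedP4 G v w u y := ⟨hwv.symm, hwu, hadj, hvu, hwy, hvy⟩
      by_cases hvx : G.Adj v x
      · have h1 : IsInducedP4 G v x y u := ⟨hvx, hxy, hadj.symm, hvy, hxu, hvu⟩
        exact hG.not_isInducedP4 (x := w) h1 h2 (by simp [hvw'.symm, hwx.ne, hyw.symm, hwu.ne])
          (by simp) (by simp)
      · have h1 : IsInducedP4 G v w x y := ⟨hwv.symm, hwx, hxy, hvx, hwy, hvy⟩
        exact hG.not_isInducedP4 (x := u) h1 h2 (by simp [hvu'.symm, hwu.ne', hux, huy'])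
          (by simp) (by simp)
  · have hP : IsInducedP4 G u w x y :=
      ⟨hwu.symm, hwx, hxy, fun h => hxu h.symm, hwy, hadj⟩
    refine hG.isThinSpider hconn hP ?_
    -- Either `v` sees only the midpoints of the path, giving a sun on the triangle `w x f`, or it
    -- sees the whole path, giving the four-cycle `u f y v`.
    have key : ∀ f, G.Adj f u ∧ G.Adj f w ∧ G.Adj f x ∧ G.Adj f y →
        ∃ p, T.Adj p u ∧ T.Adj p y ∧ T.Adj p f := by
      rintro f ⟨hfu, hfw, hfx, hfy⟩
      obtain ⟨v, hwv, hvf, hfv⟩ := hmax hfw.symm hfy hwy hyw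
      have hvu : v ≠ u := fun e => hfv (e ▸ hfu)
      have hvx : v ≠ x := fun e => hfv (e ▸ hfx)
      have hvy : v ≠ y := fun e => hfv (e ▸ hfy)
      rcases hG.adj_cases hP (x := v) (by simp [hvu, hvx, hvy, hwv.ne']) with h | h | h
      · exact absurd hwv.symm h.2.1
      · obtain ⟨p, -, -, h1, h2, h3, -⟩ := hT.exists_center_of_sun (x := w) (y := x) (z := f)
          (x' := y) (y' := u) (z' := v) hwx hfx.symm hfw.symm hwy hwu hwv hxy hxu h.2.2.1.symm
          hfy hfu hfv hyw.symm hux.symm hvf.symm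
        exact ⟨p, h3, h2, h1⟩
      · obtain ⟨p, h1, h2, h3, -⟩ := hT.exists_center_of_isInducedC4
          (⟨hfu.symm, hfy, h.2.2.2.symm, h.1, hadj, hfv, huy, hvf.symm⟩ : IsInducedC4 G u f y v)
        exact ⟨p, h1, h3, h2⟩
    intro f hf
    obtain ⟨p, hpu, hpy, -⟩ := key f hf
    -- The centre `p` sees both ends of the path, hence all of it. Applying `key` to `p` itself
    -- gives `q` attached to both ends of the tree edge `pu`.
    have hp : G.Adj p u ∧ G.Adj p w ∧ G.Adj p x ∧ G.Adj p y := by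
      have h1 := hle hpu
      have h2 := hle hpy
      have hpw : p ≠ w := fun e => hwy (e ▸ h2)
      have hpx : p ≠ x := fun e => hxu (e ▸ h1)
      rcases hG.adj_cases hP (x := p) (by simp [h1.ne, h2.ne, hpw, hpx]) with h | h | h
      exacts [absurd h1 h.1, absurd h1 h.1, h]
    obtain ⟨q, hqu, -, hqp⟩ := key p hp
    exact htri hqp hpu hqu

end Forward

/-! ### Construction of tree `2`-spanners. -/

section Backward

variable {V : Type*} {G T : SimpleGraph V}

/-- A graph given by a parent function that decreases some height is a tree. -/
theorem isTree_of_parent [Finite V] (r : V) (par : V → V) (height : V → ℕ)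
    (hadj : ∀ v, v ≠ r → T.Adj v (par v)) (hlt : ∀ v, v ≠ r → height (par v) < height v)
    (hT : ∀ u v, T.Adj u v → (u ≠ r ∧ v = par u) ∨ (v ≠ r ∧ u = par v)) : T.IsTree := by
  have hreach : ∀ m v, height v ≤ m → T.Reachable v r := by
    intro m
    induction m with
    | zero =>
      intro v hv
      by_cases hvr : v = r
      · rw [hvr]
      · have := hlt v hvr
        omega
    | succ m ih =>
      intro v hv
      by_cases hvr : v = r
      · rw [hvr]
      · have := hlt v hvr
        exact (hadj v hvr).reachable.trans (ih _ (by omega))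
  have hconn : T.Connected := by
    have : Nonempty V := ⟨r⟩
    exact ⟨fun u v => (hreach _ u le_rfl).trans (hreach _ v le_rfl).symm⟩
  refine SimpleGraph.isTree_iff_connected_and_card.2
    ⟨hconn, le_antisymm ?_ hconn.card_vert_le_card_edgeSet_add_one⟩
  -- Every edge joins some vertex other than the root to its parent, so the number of edges is less
  -- than the number of vertices.
  have hsub : T.edgeSet ⊆ (fun v => s(v, par v)) '' ({r}ᶜ : Set V) := by
    intro e
    induction e with
    | h u v =>
      intro he
      rcases hT u v he with ⟨h1, h2⟩ | ⟨h1, h2⟩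
      · exact ⟨u, h1, by rw [h2]⟩
      · exact ⟨v, h1, by rw [h2, Sym2.eq_swap]⟩
  have h1 := Set.ncard_le_ncard hsub (Set.toFinite _)
  have h2 := Set.ncard_image_le (f := fun v => s(v, par v)) (Set.toFinite ({r}ᶜ : Set V))
  have h3 := Set.ncard_add_ncard_compl ({r} : Set V)
  rw [Set.ncard_singleton] at h3
  rw [Nat.card_coe_set_eq]
  omega

/-- It suffices to check the distances of adjacent vertices. -/
theorem isTreeSpanner_of_adj {t : ℕ} (hle : T ≤ G) (hT : T.IsTree)
    (h : ∀ u v, G.Adj u v → T.dist u v ≤ t) : IsTreeSpanner G t T := by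
  refine ⟨hle, hT, fun u v => ?_⟩
  have key : ∀ {u v} (p : G.Walk u v), T.dist u v ≤ t * p.length := by
    intro u v p
    induction p with
    | nil => simp
    | @cons a b c hab p ih =>
      have h1 := hT.connected.dist_triangle (u := a) (v := b) (w := c)
      have h2 := h a b hab
      rw [SimpleGraph.Walk.length_cons, mul_add, mul_one]
      omega
  obtain ⟨p, hp⟩ := (hT.connected.mono hle).exists_walk_length_eq_dist u v
  exact hp ▸ key p

/-- A graph with a vertex adjacent to all the others except for some vertices of degree one is
`2`-admissible. -/
theorem isAdmissible_two_of_pendants [Finite V] {r : V} {S : Set V} {f : V → V} (hr : r ∉ S)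
    (hrS : ∀ v, v ∉ S → v ≠ r → G.Adj v r) (hS : ∀ s ∈ S, f s ∉ S)
    (hf : ∀ s ∈ S, G.neighborSet s = {f s}) : IsAdmissible G 2 := by
  classical
  let par : V → V := fun v => if v ∈ S then f v else r
  let T : SimpleGraph V := SimpleGraph.fromRel fun u v => u ≠ r ∧ v = par u
  have hG : ∀ v, v ≠ r → G.Adj v (par v) := by
    intro v hv
    by_cases hvS : v ∈ S
    · have : f v ∈ G.neighborSet v := by rw [hf v hvS]; rfl
      simpa [par, hvS] using this
    · simpa [par, hvS] using hrS v hvS hv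
  have hadj : ∀ v, v ≠ r → T.Adj v (par v) := fun v hv =>
    (SimpleGraph.fromRel_adj _ _ _).2 ⟨(hG v hv).ne, .inl ⟨hv, rfl⟩⟩
  have hT : ∀ u v, T.Adj u v → (u ≠ r ∧ v = par u) ∨ (v ≠ r ∧ u = par v) := fun u v h =>
    ((SimpleGraph.fromRel_adj _ _ _).1 h).2
  have hle : T ≤ G := by
    intro u v h
    rcases hT u v h with ⟨h1, rfl⟩ | ⟨h1, rfl⟩
    exacts [hG u h1, (hG v h1).symm]
  have htree : T.IsTree := by
    -- Pendants get height `2` because their neighbour may be `r` or a child of `r`.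
    refine isTree_of_parent r par (fun v => if v ∈ S then 2 else if v = r then 0 else 1) hadj ?_ hT
    intro v hv
    by_cases hvS : v ∈ S
    · simp only [par, hvS, hS v hvS, if_true, if_false]
      split_ifs <;> omega
    · simp [par, hvS, hr, hv]
  refine ⟨T, isTreeSpanner_of_adj hle htree ?_⟩
  have hleaf : ∀ s ∈ S, ∀ v, G.Adj s v → T.dist s v ≤ 2 := by
    intro s hs v hsv
    have h1 : v = f s := by
      have : v ∈ G.neighborSet s := hsv
      rwa [hf s hs] at this
    have h2 := hadj s (fun e => hr (e ▸ hs))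
    simp only [par, hs, if_true, ← h1] at h2
    rw [SimpleGraph.dist_eq_one_iff_adj.2 h2]
    omega
  have hcenter : ∀ v, v ∉ S → T.dist v r ≤ 1 := by
    intro v hv
    by_cases hvr : v = r
    · simp [hvr]
    · have h2 := hadj v hvr
      simp only [par, hv, if_false] at h2
      rw [SimpleGraph.dist_eq_one_iff_adj.2 h2]
  intro u v huv
  by_cases hu : u ∈ S
  · exact hleaf u hu v huv
  by_cases hv : v ∈ S
  · rw [SimpleGraph.dist_comm]
    exact hleaf v hv u huv.symm
  have h1 := htree.connected.dist_triangle (u := u) (v := r) (w := v)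
  have h2 := hcenter u hu
  have h3 := hcenter v hv
  rw [SimpleGraph.dist_comm] at h3
  omega

theorem HasUniversalVertex.isAdmissible_two [Finite V] (h : HasUniversalVertex G) :
    IsAdmissible G 2 := by
  obtain ⟨r, hr⟩ := h
  exact isAdmissible_two_of_pendants (S := ∅) (f := id) (by simp) (fun v _ hv => (hr v hv).symm)
    (by simp) (by simp)

theorem IsThinSpider.isAdmissible_two [Finite V] (h : IsThinSpider G) : IsAdmissible G 2 := by
  classical
  obtain ⟨S, K, R, hp, f, hf⟩ := h
  obtain ⟨r, hr⟩ : K.Nonempty := Finset.card_pos.1 (by have := hp.two_le; omega)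
  refine isAdmissible_two_of_pendants (r := r) (S := S)
    (f := fun v => if hv : v ∈ S then (f ⟨v, hv⟩).1 else v) ?_ ?_ ?_ ?_
  · exact fun h => Finset.disjoint_left.1 hp.disjoint_S_K h hr
  · intro v hv hvr
    rcases hp.cover v with h | h | h
    exacts [absurd h hv, hp.clique h hr hvr, hp.adj_R_K v h r hr]
  · intro s hs
    have hs' : s ∈ S := hs
    simp only [hs', dif_pos]
    exact fun h => Finset.disjoint_left.1 hp.disjoint_S_K h (f ⟨s, hs'⟩).2
  · intro s hs
    have hs' : s ∈ S := hs
    simp only [hs', dif_pos]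
    exact hf ⟨s, hs'⟩

/-- The `2`-admissible `P₄`-sparse graphs. -/
theorem IsP4Sparse.isAdmissible_two_iff [Finite V] (hG : IsP4Sparse G) :
    IsAdmissible G 2 ↔ HasUniversalVertex G ∨ IsThinSpider G := by
  have := Fintype.ofFinite V
  constructor
  · rintro ⟨T, hT⟩
    exact hG.hasUniversalVertex_or_isThinSpider hT
  · rintro (h | h)
    exacts [h.isAdmissible_two, h.isAdmissible_two]

end Backward

/-! ### Recognition from the degree sequence, for arbitrary finite graphs. -/

section Degrees

variable {V : Type*} [Fintype V] [DecidableEq V] {G : SimpleGraph V} [DecidableRel G.Adj]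

theorem hasUniversalVertex_iff_exists_degree :
    HasUniversalVertex G ↔ ∃ v, G.degree v = Fintype.card V - 1 := by
  refine exists_congr fun v => ?_
  have hsub : G.neighborFinset v ⊆ Finset.univ.erase v := by
    intro w hw
    simp only [SimpleGraph.mem_neighborFinset] at hw
    simp [hw.ne']
  have hcard : (Finset.univ.erase v).card = Fintype.card V - 1 := by
    rw [Finset.card_erase_of_mem (Finset.mem_univ _), Finset.card_univ]
  rw [← hcard, ← SimpleGraph.card_neighborFinset_eq_degree]
  constructor
  · intro h
    congr 1
    refine hsub.antisymm fun w hw => ?_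
    simpa using h w (Finset.ne_of_mem_erase hw)
  · intro h w hw
    have := Finset.eq_of_subset_of_card_le hsub h.ge
    rw [← SimpleGraph.mem_neighborFinset, this]
    simpa using hw

/-- Thin spiders are characterized by their degree sequence. -/
theorem isThinSpider_iff_degree :
    IsThinSpider G ↔ ∃ k, (Finset.univ.filter fun v => G.degree v = 1).card = k ∧ 2 ≤ k ∧
      Fintype.card V - k ≠ 1 ∧
      k ≤ (Finset.univ.filter fun v => G.degree v = Fintype.card V - k).card := by
  constructor
  · rintro ⟨S, K, R, hp, f, hf⟩
    have hSK := Finset.disjoint_left.1 hp.disjoint_S_K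
    have hSR := Finset.disjoint_left.1 hp.disjoint_S_R
    have hle : S.card + K.card ≤ Fintype.card V := by
      rw [← Finset.card_union_of_disjoint hp.disjoint_S_K]
      exact Finset.card_le_univ _
    have h2 := hp.two_le
    have hadj : ∀ x : {x // x ∈ S}, ∀ v, G.Adj x.1 v ↔ v = (f x).1 := fun x v => by
      rw [← SimpleGraph.mem_neighborSet, hf, Set.mem_singleton_iff]
    -- A body vertex sees its own leg and every other vertex outside `S`.
    have hK : ∀ k ∈ K, G.degree k = Fintype.card V - K.card := by
      intro k hk
      obtain ⟨x, hx⟩ := f.surjective ⟨k, hk⟩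
      have hN : G.neighborFinset k = insert x.1 (Sᶜ.erase k) := by
        ext v
        simp only [SimpleGraph.mem_neighborFinset, Finset.mem_insert, Finset.mem_erase,
          Finset.mem_compl]
        constructor
        · intro h
          by_cases hv : v ∈ S
          · left
            have h1 := (hadj ⟨v, hv⟩ k).1 h.symm
            have h3 : f ⟨v, hv⟩ = f x := Subtype.ext (by rw [← h1, hx])
            exact congrArg Subtype.val (f.injective h3)
          · exact .inr ⟨h.ne', hv⟩
        · rintro (rfl | ⟨hvk, hv⟩)
          · refine SimpleGraph.Adj.symm ((hadj x k).2 ?_)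
            rw [hx]
          · rcases hp.cover v with h | h | h
            exacts [absurd h hv, hp.clique hk h hvk.symm, (hp.adj_R_K v h k hk).symm]
      have hkS : k ∈ Sᶜ := Finset.mem_compl.2 fun h => hSK h hk
      rw [← SimpleGraph.card_neighborFinset_eq_degree, hN,
        Finset.card_insert_of_notMem (by simp [x.2]), Finset.card_erase_of_mem hkS,
        Finset.card_compl]
      have := hp.card_eq
      omega
    have hS : (Finset.univ.filter fun v => G.degree v = 1) = S := by
      ext v
      simp only [Finset.mem_filter, Finset.mem_univ, true_and]
      constructor
      · intro hv
        rcases hp.cover v with h | h | h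
        · exact h
        · have h1 := hK v h
          have h3 := hp.card_eq
          omega
        · have h1 : K ⊆ G.neighborFinset v := fun k hk => by simpa using hp.adj_R_K v h k hk
          have h3 := Finset.card_le_card h1
          rw [SimpleGraph.card_neighborFinset_eq_degree] at h3
          omega
      · intro hv
        have : G.neighborFinset v = {(f ⟨v, hv⟩).1} := by
          ext w
          simpa using hadj ⟨v, hv⟩ w
        rw [← SimpleGraph.card_neighborFinset_eq_degree, this, Finset.card_singleton]
    have h3 := hp.card_eq
    refine ⟨K.card, hS ▸ h3, h2, by omega, Finset.card_le_card fun k hk => ?_⟩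
    simpa using hK k hk
  · rintro ⟨k, hk, h2, hne, hle⟩
    set S := Finset.univ.filter fun v => G.degree v = 1 with hSdef
    set K := Finset.univ.filter fun v => G.degree v = Fintype.card V - k with hKdef
    have hmK : ∀ v, v ∈ K ↔ G.degree v = Fintype.card V - k := by simp [hKdef]
    have hmS : ∀ v, v ∈ S ↔ G.degree v = 1 := by simp [hSdef]
    have hSK : Disjoint S K := by
      rw [Finset.disjoint_left]
      intro v hv hv'
      rw [hmS] at hv
      rw [hmK] at hv'
      omega
    have hleaf : ∀ s ∈ S, ∃ v, G.neighborFinset s = {v} := by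
      intro s hs
      rw [← Finset.card_eq_one, SimpleGraph.card_neighborFinset_eq_degree, ← hmS]
      exact hs
    choose! g hg using hleaf
    have hadj : ∀ s ∈ S, ∀ v, G.Adj s v ↔ v = g s := fun s hs v => by
      rw [← SimpleGraph.mem_neighborFinset, hg s hs, Finset.mem_singleton]
    have hcompl : ∀ v ∈ K, (Sᶜ.erase v).card + 1 = Fintype.card V - k := by
      intro v hv
      have h1 : v ∈ Sᶜ := Finset.mem_compl.2 fun h => Finset.disjoint_left.1 hSK h hv
      rw [Finset.card_erase_add_one h1, Finset.card_compl, hk]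
    -- A vertex of `K` has only `n - k - 1` other non-leaves to see, so it sees a leaf. As there are
    -- `k` leaves, each with one neighbour, and at least `k` vertices in `K`, the map `g` is a
    -- bijection from the leaves to `K`.
    have hsub : K ⊆ S.image g := by
      intro v hv
      by_contra hc
      have h1 : G.neighborFinset v ⊆ Sᶜ.erase v := by
        intro w hw
        rw [SimpleGraph.mem_neighborFinset] at hw
        refine Finset.mem_erase.2 ⟨hw.ne', Finset.mem_compl.2 fun hwS => hc ?_⟩
        exact Finset.mem_image.2 ⟨w, hwS, ((hadj w hwS v).1 hw.symm).symm⟩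
      have h3 := Finset.card_le_card h1
      have h4 := hcompl v hv
      rw [SimpleGraph.card_neighborFinset_eq_degree, (hmK v).1 hv] at h3
      omega
    have himg : (S.image g).card ≤ K.card := Finset.card_image_le.trans (hk.le.trans hle)
    have hKimg : K = S.image g := Finset.eq_of_subset_of_card_le hsub himg
    have hinj : Set.InjOn g S := by
      refine Finset.card_image_iff.1 (le_antisymm Finset.card_image_le ?_)
      rw [← hKimg, hk]
      exact hle
    have hall : ∀ v ∈ K, ∀ w, w ∉ S → w ≠ v → G.Adj w v := by
      intro v hv w hw hwv
      obtain ⟨s, hs, rfl⟩ := Finset.mem_image.1 (hKimg ▸ hv)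
      -- Since `s` is the only leaf at `g s`, the other `n - k - 1` neighbours must be all the other
      -- non-leaves.
      have h1 : (G.neighborFinset (g s)).erase s ⊆ Sᶜ.erase (g s) := by
        intro x hx
        rw [Finset.mem_erase, SimpleGraph.mem_neighborFinset] at hx
        refine Finset.mem_erase.2 ⟨hx.2.ne', Finset.mem_compl.2 fun hxS => hx.1 ?_⟩
        exact hinj hxS hs ((hadj x hxS _).1 hx.2.symm).symm
      have h3 : s ∈ G.neighborFinset (g s) := by
        rw [SimpleGraph.mem_neighborFinset]
        exact ((hadj s hs _).2 rfl).symm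
      have h4 := hcompl _ hv
      have h5 := (hmK _).1 hv
      have h6 := Finset.eq_of_subset_of_card_le h1 (by
        rw [Finset.card_erase_of_mem h3, SimpleGraph.card_neighborFinset_eq_degree]
        omega)
      have h7 : w ∈ Sᶜ.erase (g s) := by simp [hw, hwv]
      rw [← h6, Finset.mem_erase, SimpleGraph.mem_neighborFinset] at h7
      exact h7.2.symm
    refine isThinSpider_of_forall hSK ?_ (h2.trans hle) ?_ ?_ ?_
    · intro u hu v hv huv
      exact hall v hv u (fun h => Finset.disjoint_left.1 hSK h hu) huv
    · intro s hs
      refine ⟨g s, hKimg ▸ Finset.mem_image_of_mem g hs, Set.ext fun v => ?_⟩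
      simpa using hadj s hs v
    · intro v hv
      obtain ⟨s, hs, rfl⟩ := Finset.mem_image.1 (hKimg ▸ hv)
      refine ⟨s, ⟨hs, (hadj s hs _).2 rfl⟩, ?_⟩
      rintro t ⟨ht, htv⟩
      exact hinj ht hs ((hadj t ht _).1 htv).symm
    · intro r hrS hrK v hv
      exact hall v hv r hrS fun e => hrK (e ▸ hv)

end Degrees

/-! ### The program, its invariants and its running time. -/

section Machine

variable {n : ℕ} {G : SimpleGraph (Fin n)}

/-- A program that looks for a vertex of degree `n - 1` while it counts in `X 3` the `k` vertices of
degree `1`, with `n - k` in `X 5`, and then counts in `X 6` the vertices of degree `n - k`. -/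
def degreeProgram : Program :=
  -- The loops start at instructions 6 and 18, with the current vertex in `X 1` and its degree in `X
  -- 2`. Instructions 15 and 16 test `k < 2` and `n - k = 1`; 26 accepts and 27 rejects.
  [.order 0, .order 5, .order 7, .decr 7, .const 4 1, .const 8 2,
    .jumpEq 1 0 15, .degree 2 1, .jumpEq 2 7 26, .jumpEq 2 4 11, .jump 13, .incr 3, .decr 5,
    .incr 1, .jump 6,
    .jumpLt 3 8 27, .jumpEq 5 4 27, .const 1 0,
    .jumpEq 1 0 25, .degree 2 1, .jumpEq 2 5 22, .jump 23, .incr 6, .incr 1, .jump 18,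
    .jumpLt 6 3 27, .halt true, .halt false]

/-- Within `t` steps the program gets from configuration `c` to configuration `c'`. -/
def Reaches (P : Program) (A : AdjacencyLists G) (t : ℕ) (c c' : Config) : Prop :=
  -- Leaving the remaining number of steps `m` arbitrary lets program segments be composed.
  ∃ s ≤ t, ∀ m, P.run A (m + s) c = P.run A m c'

variable {A : AdjacencyLists G} {P : Program}

theorem Reaches.trans {t t' : ℕ} {c c' c'' : Config} (h : Reaches P A t c c')
    (h' : Reaches P A t' c' c'') : Reaches P A (t + t') c c'' := by
  obtain ⟨s, hs, h⟩ := h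
  obtain ⟨s', hs', h'⟩ := h'
  refine ⟨s + s', by omega, fun m => ?_⟩
  rw [← h' m, ← h, add_assoc, add_comm s']

theorem Reaches.mono {t t' : ℕ} {c c' : Config} (h : Reaches P A t c c') (ht : t ≤ t') :
    Reaches P A t' c c' :=
  let ⟨s, hs, h⟩ := h
  ⟨s, hs.trans ht, h⟩

theorem run_add_of_run (t s : ℕ) (c : Config) (b : Bool) (h : P.run A t c = some b) :
    P.run A (t + s) c = some b := by
  induction t generalizing c with
  | zero => simp [Program.run] at h
  | succ t ih =>
    rw [Nat.succ_add]
    unfold Program.run at h ⊢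
    split at h <;> simp_all

/-- The memory during the first pass, when the vertices below `j` have been handled. -/
structure FirstPass (A : AdjacencyLists G) (j : ℕ) (M : ℕ → ℕ) : Prop where
  m0 : M 0 = n
  m1 : M 1 = j
  m3 : M 3 = Nat.count (fun i => A.degreeAt i = 1) j
  m4 : M 4 = 1
  m5 : M 5 = n - Nat.count (fun i => A.degreeAt i = 1) j
  m6 : M 6 = 0
  m7 : M 7 = n - 1
  m8 : M 8 = 2

/-- The memory during the second pass, when the vertices below `j` have been handled. -/
structure SecondPass (A : AdjacencyLists G) (k j : ℕ) (M : ℕ → ℕ) : Prop where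
  m0 : M 0 = n
  m1 : M 1 = j
  m3 : M 3 = k
  m5 : M 5 = n - k
  m6 : M 6 = Nat.count (fun i => A.degreeAt i = n - k) j

open Function in
theorem FirstPass.step {j : ℕ} {M : ℕ → ℕ} (h : FirstPass A j M) (hj : j ≠ n)
    (hd : A.degreeAt j ≠ n - 1) :
    ∃ M', FirstPass A (j + 1) M' ∧ Reaches degreeProgram A 8 ⟨6, M⟩ ⟨6, M'⟩ := by
  obtain ⟨h0, h1, h3, h4, h5, h6, h7, h8⟩ := h
  by_cases h : A.degreeAt j = 1
  · refine ⟨update (update (update (update M 2 1) 3 (M 3 + 1)) 5 (M 5 - 1)) 1 (j + 1), ?_,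
      8, le_rfl, fun m => ?_⟩
    · constructor <;> simp [h0, h3, h4, h5, h6, h7, h8, Nat.count_succ, h, Nat.sub_sub]
    · rw [h] at hd
      simp [Program.run, degreeProgram, Instr.exec, Config.write, h0, h1, h4, h7, hj, hd, h]
  · refine ⟨update (update M 2 (A.degreeAt j)) 1 (j + 1), ?_, 7, by omega, fun m => ?_⟩
    · constructor <;> simp [h0, h3, h4, h5, h6, h7, h8, Nat.count_succ, h]
    · simp [Program.run, degreeProgram, Instr.exec, Config.write, h0, h1, h4, h7, hj, hd, h]

open Function in
theorem FirstPass.step_of_universal {j : ℕ} {M : ℕ → ℕ} (h : FirstPass A j M) (hj : j ≠ n)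
    (hd : A.degreeAt j = n - 1) : ∃ M', Reaches degreeProgram A 3 ⟨6, M⟩ ⟨26, M'⟩ := by
  obtain ⟨h0, h1, h3, h4, h5, h6, h7, h8⟩ := h
  refine ⟨update M 2 (A.degreeAt j), 3, le_rfl, fun m => ?_⟩
  simp [Program.run, degreeProgram, Instr.exec, Config.write, h0, h1, h7, hj, hd]

open Function in
theorem SecondPass.step {k j : ℕ} {M : ℕ → ℕ} (h : SecondPass A k j M) (hj : j ≠ n) :
    ∃ M', SecondPass A k (j + 1) M' ∧ Reaches degreeProgram A 6 ⟨18, M⟩ ⟨18, M'⟩ := by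
  obtain ⟨h0, h1, h3, h5, h6⟩ := h
  by_cases h : A.degreeAt j = n - k
  · refine ⟨update (update (update M 2 (n - k)) 6 (M 6 + 1)) 1 (j + 1), ?_, 6, le_rfl, fun m => ?_⟩
    · constructor <;> simp [h0, h3, h5, h6, Nat.count_succ, h]
    · simp [Program.run, degreeProgram, Instr.exec, Config.write, h0, h1, h5, hj, h]
  · refine ⟨update (update M 2 (A.degreeAt j)) 1 (j + 1), ?_, 6, le_rfl, fun m => ?_⟩
    · constructor <;> simp [h0, h3, h5, h6, Nat.count_succ, h]
    · simp [Program.run, degreeProgram, Instr.exec, Config.write, h0, h1, h5, hj, h]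

theorem FirstPass.reaches {j : ℕ} {M : ℕ → ℕ} (h : FirstPass A j M) (d : ℕ) (hd : j + d = n) :
    ((∃ i < n, A.degreeAt i = n - 1) ∧
        ∃ M', Reaches degreeProgram A (8 * d + 1) ⟨6, M⟩ ⟨26, M'⟩) ∨
      ((∀ i, j ≤ i → i < n → A.degreeAt i ≠ n - 1) ∧
        ∃ M', FirstPass A n M' ∧ Reaches degreeProgram A (8 * d + 1) ⟨6, M⟩ ⟨15, M'⟩) := by
  induction d generalizing j M with
  | zero =>
    obtain rfl : j = n := hd
    refine .inr ⟨fun i h1 h2 => by omega, M, h, 1, le_rfl, fun m => ?_⟩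
    simp [Program.run, degreeProgram, Instr.exec, h.m0, h.m1]
  | succ d ih =>
    by_cases hu : A.degreeAt j = n - 1
    · obtain ⟨M', hM'⟩ := h.step_of_universal (by omega) hu
      exact .inl ⟨⟨j, by omega, hu⟩, M', hM'.mono (by omega)⟩
    · obtain ⟨M₁, hM₁, hr⟩ := h.step (by omega) hu
      rcases ih hM₁ (by omega) with ⟨h1, M', hM'⟩ | ⟨h1, M', h2, hM'⟩
      · exact .inl ⟨h1, M', (hr.trans hM').mono (by omega)⟩
      · refine .inr ⟨fun i hi hin => ?_, M', h2, (hr.trans hM').mono (by omega)⟩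
        rcases hi.eq_or_lt with rfl | hi
        exacts [hu, h1 i hi hin]

theorem SecondPass.reaches {k j : ℕ} {M : ℕ → ℕ} (h : SecondPass A k j M) (d : ℕ)
    (hd : j + d = n) :
    ∃ M', SecondPass A k n M' ∧ Reaches degreeProgram A (6 * d + 1) ⟨18, M⟩ ⟨25, M'⟩ := by
  induction d generalizing j M with
  | zero =>
    obtain rfl : j = n := hd
    refine ⟨M, h, 1, le_rfl, fun m => ?_⟩
    simp [Program.run, degreeProgram, Instr.exec, h.m0, h.m1]
  | succ d ih =>
    obtain ⟨M₁, hM₁, hr⟩ := h.step (by omega)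
    obtain ⟨M', h2, hM'⟩ := ih hM₁ (by omega)
    exact ⟨M', h2, (hr.trans hM').mono (by omega)⟩

/-- The inequality `t < T` is strict because the `halt` instruction itself takes a step. -/
theorem Reaches.run_eq {t T : ℕ} {c c' : Config} {b : Bool} (h : Reaches P A t c c')
    (hc : P[c'.pc]? = some (.halt b)) (hT : t < T) : P.run A T c = some b := by
  obtain ⟨s, hs, h⟩ := h
  obtain ⟨r, rfl⟩ := Nat.exists_eq_add_of_le (show 1 + s ≤ T by omega)
  refine run_add_of_run _ _ _ _ ?_
  rw [h]
  simp [Program.run, hc]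

open Function in
/-- What the program decides. -/
theorem degreeProgram_decidesWithin (A : AdjacencyLists G) :
    -- Initialisation takes 6 steps, the passes at most `8 * n + 1` and `6 * n + 1`, the tests at
    -- most 4 and `halt` 1; the rest of the bound is slack.
    degreeProgram.DecidesWithin A (14 * n + 20)
      ((∃ i < n, A.degreeAt i = n - 1) ∨
        ∃ k, Nat.count (fun i => A.degreeAt i = 1) n = k ∧ 2 ≤ k ∧ n - k ≠ 1 ∧
          k ≤ Nat.count (fun i => A.degreeAt i = n - k) n) := by
  have hstart : ∃ M, FirstPass A 0 M ∧ Reaches degreeProgram A 6 Config.init ⟨6, M⟩ := by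
    refine ⟨update (update (update (update (update (fun _ => 0) 0 n) 5 n) 7 (n - 1)) 4 1) 8 2, ?_,
      6, le_rfl, fun m => ?_⟩
    · constructor <;> simp
    · simp [Program.run, degreeProgram, Instr.exec, Config.write, Config.init]
  obtain ⟨M, hM, hr⟩ := hstart
  rcases hM.reaches n (by omega) with ⟨hu, M', hM'⟩ | ⟨hu, M₁, hM₁, hr₁⟩
  · exact ⟨true, (hr.trans hM').run_eq rfl (by omega), by simp [hu]⟩
  replace hu : ¬ ∃ i < n, A.degreeAt i = n - 1 := fun ⟨i, h1, h2⟩ => hu i (by omega) h1 h2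
  replace hr := hr.trans hr₁
  simp only [hu, false_or, exists_eq_left']
  set k := Nat.count (fun i => A.degreeAt i = 1) n with hk
  have h3 := hM₁.m3; have h4 := hM₁.m4; have h5 := hM₁.m5; have h8 := hM₁.m8
  rw [← hk] at h3 h5
  by_cases hk2 : k < 2
  · have hr₂ : Reaches degreeProgram A 1 ⟨15, M₁⟩ ⟨27, M₁⟩ := by
      refine ⟨1, le_rfl, fun m => ?_⟩
      simp [Program.run, degreeProgram, Instr.exec, h3, h8, hk2]
    exact ⟨false, (hr.trans hr₂).run_eq rfl (by omega), by simp; omega⟩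
  by_cases hk1 : n - k = 1
  · have hr₂ : Reaches degreeProgram A 2 ⟨15, M₁⟩ ⟨27, M₁⟩ := by
      refine ⟨2, le_rfl, fun m => ?_⟩
      simp [Program.run, degreeProgram, Instr.exec, h3, h8, hk2, h4, h5, hk1]
    exact ⟨false, (hr.trans hr₂).run_eq rfl (by omega), by simp; omega⟩
  have hr₂ : Reaches degreeProgram A 3 ⟨15, M₁⟩ ⟨18, update M₁ 1 0⟩ := by
    refine ⟨3, le_rfl, fun m => ?_⟩
    simp [Program.run, degreeProgram, Instr.exec, Config.write, h3, h8, hk2, h4, h5, hk1]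
  have hS : SecondPass A k 0 (update M₁ 1 0) := by
    constructor <;> simp [hM₁.m0, h3, h5, hM₁.m6]
  obtain ⟨M₂, hM₂, hr₃⟩ := hS.reaches n (by omega)
  replace hr := (hr.trans hr₂).trans hr₃
  have h3 := hM₂.m3; have h6 := hM₂.m6
  by_cases hlt : Nat.count (fun i => A.degreeAt i = n - k) n < k
  · have hr₄ : Reaches degreeProgram A 1 ⟨25, M₂⟩ ⟨27, M₂⟩ := by
      refine ⟨1, le_rfl, fun m => ?_⟩
      simp [Program.run, degreeProgram, Instr.exec, h3, h6, hlt]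
    exact ⟨false, (hr.trans hr₄).run_eq rfl (by omega), by simp; omega⟩
  · have hr₄ : Reaches degreeProgram A 1 ⟨25, M₂⟩ ⟨26, M₂⟩ := by
      refine ⟨1, le_rfl, fun m => ?_⟩
      simp [Program.run, degreeProgram, Instr.exec, h3, h6, hlt]
    exact ⟨true, (hr.trans hr₄).run_eq rfl (by omega), by simp; omega⟩

theorem AdjacencyLists.degreeAt_eq_degree [DecidableRel G.Adj] (A : AdjacencyLists G) (v : Fin n) :
    A.degreeAt v = G.degree v := by
  have : G.neighborFinset v = (A.nbrs v).toFinset := by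
    ext w
    simp [A.mem_nbrs]
  rw [← SimpleGraph.card_neighborFinset_eq_degree, this, List.toFinset_card_of_nodup (A.nodup v)]
  simp [AdjacencyLists.degreeAt]

theorem count_eq_card_filter_univ_fin (p : ℕ → Prop) [DecidablePred p] (n : ℕ) :
    Nat.count p n = (Finset.univ.filter fun v : Fin n => p v).card := by
  rw [Nat.count_eq_card_filter_range, Finset.card_filter, Finset.card_filter, Finset.sum_range]

theorem degreeProgram_decides_isAdmissible (hG : IsP4Sparse G) (A : AdjacencyLists G) :
    degreeProgram.DecidesWithin A (14 * n + 20) (IsAdmissible G 2) := by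
  classical
  obtain ⟨b, hb, hiff⟩ := degreeProgram_decidesWithin A
  refine ⟨b, hb, hiff.trans ?_⟩
  rw [hG.isAdmissible_two_iff, hasUniversalVertex_iff_exists_degree, isThinSpider_iff_degree]
  simp only [count_eq_card_filter_univ_fin, A.degreeAt_eq_degree, Fintype.card_fin]
  refine or_congr_left ⟨fun ⟨i, hi, h⟩ => ⟨⟨i, hi⟩, ?_⟩, fun ⟨v, h⟩ => ⟨v, v.2, ?_⟩⟩
  · rw [← A.degreeAt_eq_degree]
    exact h
  · rw [A.degreeAt_eq_degree]
    exact h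

end Machine

end Admissibility

theorem mainTheorem9 :
    (∀ (n : ℕ) (G : SimpleGraph (Fin n)), Admissibility.IsP4Sparse G →
      (Admissibility.IsAdmissible G 2 ↔
        Admissibility.HasUniversalVertex G ∨ Admissibility.IsThinSpider G)) ∧
    ∃ (P : Admissibility.Program) (T : ℕ → ℕ),
      P.UsesOnlyDegrees ∧
      Asymptotics.IsBigO Filter.atTop (fun n : ℕ => (T n : ℝ)) (fun n : ℕ => (n : ℝ)) ∧
      ∀ (n : ℕ) (G : SimpleGraph (Fin n)) (A : Admissibility.AdjacencyLists G),
        Admissibility.IsP4Sparse G →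
          P.DecidesWithin A (T n) (Admissibility.IsAdmissible G 2) := by
  refine ⟨fun n G hG => hG.isAdmissible_two_iff, Admissibility.degreeProgram,
    fun n => 14 * n + 20, ?_, ?_, fun n G A hG =>
      Admissibility.degreeProgram_decides_isAdmissible hG A⟩
  · intro d v i
    simp [Admissibility.degreeProgram]
  -- For `n ≥ 1` the constant term 20 is at most `20 * n`, whence 34 = 14 + 20.
  · refine Asymptotics.IsBigO.of_bound 34 (Filter.eventually_atTop.2 ⟨1, fun n hn => ?_⟩)
    have hn' : (1 : ℝ) ≤ n := by exact_mod_cast hn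
    rw [Real.norm_of_nonneg (by positivity), Real.norm_of_nonneg (by positivity)]
    push_cast
    linarith
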